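/- Let $F$ be a field of characteristic $p\ge 0$, let $r\ge 0$ and $d_1,\dots,d_r\ge 0$ be integers, and put $n=d_1+\cdots+d_r$. Assume that $p=0$ or $p>n$. Let $$B=F[y_1,\dots,y_r]/(y_1^{d_1+1},\dots,y_r^{d_r+1})$$ be the monomial complete intersection ring, with the grading induced by the standard grading $\deg y_i=1$ of the polynomial ring, so that $B_j$, the homogeneous component of degree $j$, is the space of classes of homogeneous polynomials of degree $j$. Then for every integer $k$ with $0\le k\le n/2$, multiplication by $(y_1+\cdots+y_r)^{n-2k}$ maps $B_k$ into $B_{n-k}$, and the multiplication map $$\times (y_1+y_2+\cdots+y_r)^{n-2k}\colon B_k\to B_{n-k}$$ is a bijection. -/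

import Mathlib

/-- The ideal `(y_1^{d_1+1}, …, y_r^{d_r+1})` of the polynomial ring `F[y_1, …, y_r]`. -/
noncomputable def monomialCIIdeal (F : Type*) [Field F] {r : ℕ} (d : Fin r → ℕ) :
    Ideal (MvPolynomial (Fin r) F) :=
  Ideal.span (Set.range fun i : Fin r => (MvPolynomial.X i : MvPolynomial (Fin r) F) ^ (d i + 1))

/-- The monomial complete intersection ring
`F[y_1, …, y_r] / (y_1^{d_1+1}, …, y_r^{d_r+1})`. -/
abbrev MonomialCI (F : Type*) [Field F] {r : ℕ} (d : Fin r → ℕ) : Type _ :=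
  MvPolynomial (Fin r) F ⧸ monomialCIIdeal F d

namespace MonomialCI

/-- The class of the variable `y_i` in the monomial complete intersection ring. -/
noncomputable def y (F : Type*) [Field F] {r : ℕ} (d : Fin r → ℕ) (i : Fin r) : MonomialCI F d :=
  Ideal.Quotient.mk (monomialCIIdeal F d) (MvPolynomial.X i)

/-- The homogeneous component of degree `k` of the monomial complete intersection ring, in the
grading induced by the standard grading of `F[y_1, …, y_r]`: the `F`-subspace of classes of
homogeneous polynomials of degree `k`. -/
noncomputable def component (F : Type*) [Field F] {r : ℕ} (d : Fin r → ℕ) (k : ℕ) :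
    Submodule F (MonomialCI F d) :=
  (MvPolynomial.homogeneousSubmodule (Fin r) F k).map
    (Ideal.Quotient.mkₐ F (monomialCIIdeal F d)).toLinearMap

end MonomialCI

/-! Let `E` be multiplication by `∑ y_i` and `D` the operator induced by `∑ (d_i ∂_i - y_i ∂_i ^
2)`. As for `sl₂`, `E D - D E` is a scalar on each degree, so on degree `k`, with `N = n - 2 k`,
both `D ^ N E ^ N` and `E ^ (k+1) D ^ (k+1)` are explicit products of linear polynomials in `E D`.
The second is zero, since `D ^ (k+1)` leads to negative degree. The two polynomials are coprime when
`1, …, n - k` are invertible in `F`, so Bézout inverts `D ^ N E ^ N` and `E ^ N` is injective.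
Surjectivity follows by exchanging `E` and `D`. -/

open Polynomial in
/-- A product of linear polynomials `X + a i` is coprime to a product of linear polynomials
`X - b j` as soon as no `a i + b j` vanishes. -/
theorem isCoprime_prod_X_add_C_prod_X_sub_C {F ι κ : Type*} [Field F] (s : Finset ι)
    (t : Finset κ) (a : ι → F) (b : κ → F) (h : ∀ i ∈ s, ∀ j ∈ t, a i + b j ≠ 0) :
    IsCoprime (∏ i ∈ s, (X + C (a i))) (∏ j ∈ t, (X - C (b j))) := by
  refine IsCoprime.prod_left fun i hi => IsCoprime.prod_right fun j hj => ?_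
  have := Polynomial.isCoprime_X_sub_C_of_isUnit_sub (a := - a i) (b := b j)
    (isUnit_iff_ne_zero.mpr fun h0 => h i hi j hj (by linear_combination -h0))
  simpa using this

/-! ### Abstract Lefschetz pairs -/

/-- A pair of operators of degrees `1` and `-1` on a family of subspaces, whose commutator acts
on the `j`-th subspace as the scalar `2 j - n`. -/
structure IsLefschetzPair {F M : Type*} [Field F] [AddCommGroup M] [Module F M] (n : ℤ)
    (V : ℤ → Submodule F M) (E D : Module.End F M) : Prop where
  raise : ∀ j, ∀ x ∈ V j, E x ∈ V (j + 1)
  lower : ∀ j, ∀ x ∈ V j, D x ∈ V (j - 1)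
  comm : ∀ j, ∀ x ∈ V j, E (D x) = D (E x) + ((2 * j - n : ℤ) : F) • x

namespace IsLefschetzPair

variable {F M : Type*} [Field F] [AddCommGroup M] [Module F M] {n : ℤ}
  {V : ℤ → Submodule F M} {E D : Module.End F M}

/-- Swapping the operators negates the commutator, and `j ↦ n - j` negates `2 j - n`. -/
theorem symm (h : IsLefschetzPair n V E D) : IsLefschetzPair n (fun j => V (n - j)) D E where
  raise j x hx := by
    have := h.lower _ x hx
    rwa [show n - j - 1 = n - (j + 1) by ring] at this
  lower j x hx := by
    have := h.raise _ x hx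
    rwa [show n - j + 1 = n - (j - 1) by ring] at this
  comm j x hx := by
    rw [h.comm _ x hx, add_assoc, ← add_smul]
    rw [show (((2 * (n - j) - n : ℤ) : F) + ((2 * j - n : ℤ) : F)) = 0 by push_cast; ring]
    simp

theorem pow_raise (h : IsLefschetzPair n V E D) (m : ℕ) {j : ℤ} {x : M} (hx : x ∈ V j) :
    (E ^ m) x ∈ V (j + m) := by
  induction m with
  | zero => simpa using hx
  | succ m ih =>
    rw [pow_succ', Module.End.mul_apply]
    have := h.raise _ _ ih
    rwa [show j + (m : ℤ) + 1 = j + ((m + 1 : ℕ) : ℤ) by push_cast; ring] at this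

theorem pow_lower (h : IsLefschetzPair n V E D) (m : ℕ) {j : ℤ} {x : M} (hx : x ∈ V j) :
    (D ^ m) x ∈ V (j - m) := by
  have := h.symm.pow_raise m (j := n - j) (x := x) (by simpa using hx)
  simpa [sub_sub_eq_add_sub, sub_add_eq_sub_sub] using this

theorem mul_mem (h : IsLefschetzPair n V E D) {j : ℤ} {x : M} (hx : x ∈ V j) :
    (E * D) x ∈ V j := by
  have := h.raise _ _ (h.lower _ x hx)
  rwa [sub_add_cancel] at this

theorem aeval_mem (h : IsLefschetzPair n V E D) (q : Polynomial F) {j : ℤ} {x : M}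
    (hx : x ∈ V j) : Polynomial.aeval (E * D) q x ∈ V j := by
  induction q using Polynomial.induction_on' generalizing x with
  | add p q hp hq => simpa using add_mem (hp hx) (hq hx)
  | monomial m a =>
    have : ((E * D) ^ m) x ∈ V j := by
      induction m with
      | zero => simpa using hx
      | succ m ih =>
        rw [pow_succ', Module.End.mul_apply]
        exact h.mul_mem ih
    rw [Polynomial.aeval_monomial, Module.End.mul_apply, Module.algebraMap_end_apply]
    exact (V j).smul_mem a this

theorem lower_pow_raise (h : IsLefschetzPair n V E D) (m : ℕ) {j : ℤ} {x : M} (hx : x ∈ V j) :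
    D ((E ^ (m + 1)) x) =
      (E ^ m) (E (D x) + (((m + 1) * (n - 2 * j - m) : ℤ) : F) • x) := by
  induction m with
  | zero =>
    simp only [zero_add, pow_one, pow_zero, Module.End.one_apply]
    rw [h.comm j x hx, add_assoc, ← add_smul]
    rw [show (((2 * j - n : ℤ) : F) + ((((0 : ℕ) + 1) * (n - 2 * j - (0 : ℕ)) : ℤ) : F)) = 0 by
      push_cast; ring]
    simp
  | succ m ih =>
    have hc := h.comm _ _ (h.pow_raise (m + 1) hx)
    have hs : ∀ y, (E ^ (m + 1)) y = E ((E ^ m) y) := fun y => by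
      rw [pow_succ', Module.End.mul_apply]
    rw [pow_succ' E (m + 1), Module.End.mul_apply, eq_sub_of_add_eq hc.symm, ih, ← hs, map_add,
      map_add, map_smul, map_smul, add_sub_assoc, ← sub_smul]
    congr 2
    push_cast
    ring

-- Each induction step peels off the innermost `D`, `E` pair as a factor `E D + c`, which preserves
-- `V j`.
open Polynomial in
theorem lower_pow_raise_pow (h : IsLefschetzPair n V E D) (m : ℕ) {j : ℤ} {x : M}
    (hx : x ∈ V j) :
    (D ^ m) ((E ^ m) x) = aeval (E * D)
      (∏ i ∈ Finset.range m, (X + C (((i + 1) * (n - 2 * j - i) : ℤ) : F))) x := by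
  induction m generalizing x with
  | zero => simp
  | succ m ih =>
    have hy : E (D x) + (((m + 1) * (n - 2 * j - m) : ℤ) : F) • x ∈ V j :=
      add_mem (h.mul_mem hx) ((V j).smul_mem _ hx)
    rw [pow_succ D, Module.End.mul_apply, h.lower_pow_raise m hx, ih hy,
      Finset.prod_range_succ, map_mul, Module.End.mul_apply]
    congr 1
    simp only [map_add, aeval_X, aeval_C, LinearMap.add_apply, Module.End.mul_apply,
      Module.algebraMap_end_apply]

open Polynomial in
theorem raise_pow_lower_pow (h : IsLefschetzPair n V E D) (m : ℕ) {j : ℤ} {x : M}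
    (hx : x ∈ V j) :
    (E ^ m) ((D ^ m) x) = aeval (E * D)
      (∏ i ∈ Finset.range m, (X - C ((i * (n - 2 * j + i + 1) : ℤ) : F))) x := by
  induction m generalizing x with
  | zero => simp
  | succ m ih =>
    have key : E ((D ^ (m + 1)) x) =
        (D ^ m) (E (D x) - ((m * (n - 2 * j + m + 1) : ℤ) : F) • x) := by
      rw [h.symm.lower_pow_raise m (j := n - j) (by simpa using hx), h.comm j x hx,
        add_sub_assoc, ← sub_smul]
      congr 3
      push_cast
      ring
    have hy : E (D x) - ((m * (n - 2 * j + m + 1) : ℤ) : F) • x ∈ V j :=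
      sub_mem (h.mul_mem hx) ((V j).smul_mem _ hx)
    rw [pow_succ E, Module.End.mul_apply, key, ih hy,
      Finset.prod_range_succ, map_mul, Module.End.mul_apply]
    congr 1
    simp only [map_sub, aeval_X, aeval_C, LinearMap.sub_apply, Module.End.mul_apply,
      Module.algebraMap_end_apply]

/-- On the `k`-th subspace, `D ^ N * E ^ N` with `N = n - 2 k` is inverted by a polynomial
in `E * D`. -/
theorem exists_aeval_inverse (h : IsLefschetzPair n V E D) (hV : ∀ j < 0, V j = ⊥) {N k : ℕ}
    (hn : n = N + 2 * k) (hF : ∀ i : ℕ, 0 < i → i ≤ N + k → (i : F) ≠ 0) :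
    ∃ q : Polynomial F, ∀ x ∈ V k,
      Polynomial.aeval (E * D) q ((D ^ N) ((E ^ N) x)) = x ∧
      (D ^ N) ((E ^ N) (Polynomial.aeval (E * D) q x)) = x := by
  obtain ⟨q, q', hq⟩ := isCoprime_prod_X_add_C_prod_X_sub_C (Finset.range N)
    (Finset.range (k + 1)) (fun i => (((i + 1) * (n - 2 * k - i) : ℤ) : F))
    (fun i => ((i * (n - 2 * k + i + 1) : ℤ) : F)) (by
      intro i hi j hj
      rw [Finset.mem_range] at hi hj
      -- The sum of roots factors: `(i+1)(N-i) + j(N+j+1) = (i+1+j)(N-i+j)`, with both factors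
      -- between `1` and `N + k`.
      have h1 := hF (i + 1 + j) (by omega) (by omega)
      have h2 := hF (N - i + j) (by omega) (by omega)
      have h3 := mul_ne_zero h1 h2
      rw [Nat.cast_add (N - i), Nat.cast_sub hi.le] at h3
      intro h0
      apply h3
      rw [← h0, hn]
      push_cast
      ring)
  have key : ∀ x ∈ V k, Polynomial.aeval (E * D) (q * ∏ i ∈ Finset.range N,
      (Polynomial.X + Polynomial.C (((i + 1) * (n - 2 * k - i) : ℤ) : F))) x = x := by
    intro x hx
    have h0 : (D ^ (k + 1)) x = 0 := by
      have := h.pow_lower (k + 1) hx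
      rwa [hV _ (by push_cast; omega), Submodule.mem_bot] at this
    have h1 := h.raise_pow_lower_pow (k + 1) hx
    rw [h0, map_zero] at h1
    have h2 := congrArg (fun f => Polynomial.aeval (E * D) f x) hq
    simpa only [map_add, map_mul _ q', LinearMap.add_apply, Module.End.mul_apply, ← h1, map_zero,
      add_zero, map_one, Module.End.one_apply] using h2
  refine ⟨q, fun x hx => ⟨?_, ?_⟩⟩
  · rw [h.lower_pow_raise_pow N hx, ← Module.End.mul_apply, ← map_mul, key x hx]
  · rw [h.lower_pow_raise_pow N (h.aeval_mem q hx), ← Module.End.mul_apply, ← map_mul, mul_comm,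
      key x hx]

/-- The hard Lefschetz property of a Lefschetz pair over a field in which the relevant integers
are invertible. -/
theorem bijOn (h : IsLefschetzPair n V E D) (hV : ∀ j < 0, V j = ⊥) (hV' : ∀ j, n < j → V j = ⊥)
    {N k : ℕ} (hn : n = N + 2 * k) (hF : ∀ i : ℕ, 0 < i → i ≤ N + k → (i : F) ≠ 0) :
    Set.BijOn (E ^ N) (V k : Set M) (V (n - k) : Set M) := by
  refine ⟨fun x hx => ?_, fun x hx y hy hxy => ?_, fun y hy => ?_⟩
  · have := h.pow_raise N hx
    rwa [show (k : ℤ) + N = n - k by rw [hn]; ring] at this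
  · obtain ⟨q, hq⟩ := h.exists_aeval_inverse hV hn hF
    rw [← (hq x hx).1, ← (hq y hy).1, hxy]
  -- For the swapped pair, `E ^ N D ^ N` is inverted on `V (n - k)`; the preimage is `D ^ N` of that
  -- inverse at `y`.
  · obtain ⟨q, hq⟩ := h.symm.exists_aeval_inverse (fun j hj => hV' _ (by omega)) hn hF
    refine ⟨_, ?_, (hq y hy).2⟩
    have := h.pow_lower N (j := n - k) (h.symm.aeval_mem q (j := k) hy)
    rwa [show n - (k : ℤ) - N = k by rw [hn]; ring] at this

end IsLefschetzPair

/-! ### The lowering operator on the monomial complete intersection -/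

namespace MonomialCI

open MvPolynomial

variable (F : Type*) [Field F] {r : ℕ} (d : Fin r → ℕ)

/-- The differential operator `∑ i, (d i ∂_i - y_i ∂_i ^ 2)` on the polynomial ring. -/
noncomputable def loweringPoly : MvPolynomial (Fin r) F →ₗ[F] MvPolynomial (Fin r) F :=
  ∑ i, ((d i : F) • (pderiv i).toLinearMap -
    LinearMap.mulLeft F (X i) ∘ₗ (pderiv i).toLinearMap ∘ₗ (pderiv i).toLinearMap)

theorem loweringPoly_apply (f : MvPolynomial (Fin r) F) :
    loweringPoly F d f = ∑ i, (C (d i : F) * pderiv i f - X i * pderiv i (pderiv i f)) := by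
  simp [loweringPoly, smul_eq_C_mul]

-- The commutator is `∑ (2 y_i ∂_i - d_i)`, evaluated by Euler's identity.
variable {F} in
theorem sum_X_mul_loweringPoly {f : MvPolynomial (Fin r) F} {k : ℕ} (hf : f.IsHomogeneous k) :
    (∑ i, X i) * loweringPoly F d f =
      loweringPoly F d ((∑ i, X i) * f) + (2 * (k : F) - ∑ i, (d i : F)) • f := by
  have h1 : ∀ i, pderiv i (∑ j : Fin r, X j : MvPolynomial (Fin r) F) = 1 := fun i => by
    rw [map_sum, Finset.sum_eq_single i] <;> simp +contextual
  have h2 := hf.sum_X_mul_pderiv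
  simp only [loweringPoly_apply, pderiv_mul, h1, map_add, pderiv_one]
  rw [Finset.mul_sum, ← sub_eq_iff_eq_add', ← Finset.sum_sub_distrib]
  have h3 : ((2 * (k : F) - ∑ i, (d i : F)) • f) =
      ∑ i, (2 * (X i * pderiv i f) - C (d i : F) * f) := by
    rw [Finset.sum_sub_distrib, ← Finset.mul_sum, h2, ← Finset.sum_mul, ← map_sum, sub_smul,
      smul_eq_C_mul, smul_eq_C_mul, nsmul_eq_mul, map_mul, map_natCast, map_ofNat]
    ring
  rw [h3]
  exact Finset.sum_congr rfl fun i _ => by ring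

variable {F} in
theorem loweringPoly_isHomogeneous {f : MvPolynomial (Fin r) F} {k : ℕ}
    (hf : f.IsHomogeneous (k + 1)) : (loweringPoly F d f).IsHomogeneous k := by
  rw [loweringPoly_apply]
  refine IsHomogeneous.sum _ _ _ fun i _ => ?_
  have h1 : (pderiv i f).IsHomogeneous k := hf.pderiv
  refine (h1.C_mul _).sub ?_
  -- For `k = 0` the first derivative is constant, so the second-order term vanishes.
  cases k with
  | zero =>
    rw [totalDegree_eq_zero_iff_eq_C.mp (Nat.le_zero.mp h1.totalDegree_le), pderiv_C, mul_zero]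
    exact isHomogeneous_zero _ _ _
  | succ k =>
    rw [add_comm]
    exact (isHomogeneous_X F i).mul h1.pderiv

variable {F} in
theorem loweringPoly_eq_zero {f : MvPolynomial (Fin r) F} (hf : f.IsHomogeneous 0) :
    loweringPoly F d f = 0 := by
  rw [totalDegree_eq_zero_iff_eq_C.mp (Nat.le_zero.mp hf.totalDegree_le), loweringPoly_apply]
  simp

variable {F d} in
theorem X_pow_mem (i : Fin r) : (X i : MvPolynomial (Fin r) F) ^ (d i + 1) ∈ monomialCIIdeal F d :=
  Ideal.subset_span ⟨i, rfl⟩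

-- The coefficient `d_i` is chosen so that `d_i ∂_i - y_i ∂_i ^ 2` kills `y_i ^ (d_i + 1)`.
variable {F d} in
theorem loweringPoly_mem {f : MvPolynomial (Fin r) F} (hf : f ∈ monomialCIIdeal F d) :
    loweringPoly F d f ∈ monomialCIIdeal F d := by
  induction hf using Submodule.closure_induction with
  | zero => simp
  | add x y _ _ hx hy => simpa using add_mem hx hy
  | smul_mem g x hx =>
    obtain ⟨i, rfl⟩ := hx
    rw [smul_eq_mul, loweringPoly_apply]
    refine Ideal.sum_mem _ fun j _ => ?_
    refine Ideal.mem_of_dvd _ ?_ (X_pow_mem i)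
    obtain rfl | hij := eq_or_ne i j
    -- The last term of the cofactor is the cross term of the second derivative of the product.
    · refine ⟨C (d i : F) * pderiv i g - X i * pderiv i (pderiv i g)
        - 2 * ((d i + 1 : ℕ) : MvPolynomial (Fin r) F) * pderiv i g, ?_⟩
      dsimp only
      generalize d i = e
      simp only [pderiv_mul, pderiv_pow, pderiv_X_self, map_add, map_natCast, Derivation.map_natCast,
        Nat.add_sub_cancel, mul_one]
      -- The second derivative carries the truncated exponent `e - 1`.
      cases e with
      | zero =>
        simp
        ring
      | succ e =>
        simp only [Nat.add_sub_cancel]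
        push_cast
        ring
    · refine ⟨C (d j : F) * pderiv j g - X j * pderiv j (pderiv j g), ?_⟩
      simp only [pderiv_mul, pderiv_pow, pderiv_X_of_ne hij, mul_zero, add_zero]
      ring

-- By pigeonhole, each monomial of `f` has some exponent above `d i`.
variable {F d} in
theorem mem_of_isHomogeneous {f : MvPolynomial (Fin r) F} {k : ℕ} (hf : f.IsHomogeneous k)
    (hk : ∑ i, d i < k) : f ∈ monomialCIIdeal F d := by
  rw [f.as_sum]
  refine Ideal.sum_mem _ fun m hm => ?_
  have hdeg : ∑ i, m i = k := by
    rw [← Finsupp.degree_eq_sum]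
    exact not_imp_comm.mp hf.coeff_eq_zero (mem_support_iff.mp hm)
  obtain ⟨i, -, hi⟩ := Finset.exists_lt_of_sum_lt (hdeg ▸ hk)
  refine Ideal.mem_of_dvd _ ?_ (X_pow_mem i)
  rw [X_pow_eq_monomial, monomial_dvd_monomial]
  exact ⟨Or.inr (Finsupp.single_le_iff.mpr hi), one_dvd _⟩

/-- The operator on the monomial complete intersection ring induced by `loweringPoly`. -/
noncomputable def lowering : Module.End F (MonomialCI F d) :=
  ((monomialCIIdeal F d).restrictScalars F).mapQ ((monomialCIIdeal F d).restrictScalars F)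
    (loweringPoly F d) fun _ hf => loweringPoly_mem hf

theorem lowering_mk (f : MvPolynomial (Fin r) F) :
    lowering F d (Ideal.Quotient.mk (monomialCIIdeal F d) f) =
      Ideal.Quotient.mk (monomialCIIdeal F d) (loweringPoly F d f) := rfl

variable {F d} in
theorem mem_component {k : ℕ} {b : MonomialCI F d} : b ∈ component F d k ↔
    ∃ f : MvPolynomial (Fin r) F, f.IsHomogeneous k ∧
      Ideal.Quotient.mk (monomialCIIdeal F d) f = b := Iff.rfl

/-- The homogeneous components of the monomial complete intersection ring, indexed by `ℤ`. -/
noncomputable def intComponent : ℤ → Submodule F (MonomialCI F d)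
  | (k : ℕ) => component F d k
  | Int.negSucc _ => ⊥

theorem sum_y_eq_mk : ∑ i, y F d i = Ideal.Quotient.mk (monomialCIIdeal F d) (∑ i, X i) := by
  rw [map_sum]
  rfl

theorem isLefschetzPair : IsLefschetzPair ((∑ i, d i : ℕ) : ℤ) (intComponent F d)
    (LinearMap.mulLeft F (∑ i, y F d i)) (lowering F d) where
  raise j x hx := by
    match j, hx with
    | (k : ℕ), hx =>
      obtain ⟨f, hf, rfl⟩ := mem_component.mp hx
      refine mem_component.mpr ⟨(∑ i, X i) * f, ?_, ?_⟩
      · rw [add_comm k]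
        exact (IsHomogeneous.sum _ _ _ fun i _ => isHomogeneous_X F i).mul hf
      · rw [map_mul, ← sum_y_eq_mk, LinearMap.mulLeft_apply]
    | Int.negSucc k, hx =>
      rw [(Submodule.mem_bot F).mp hx, map_zero]
      exact zero_mem _
  lower j x hx := by
    match j, hx with
    | (0 : ℕ), hx =>
      obtain ⟨f, hf, rfl⟩ := mem_component.mp hx
      rw [lowering_mk, loweringPoly_eq_zero d hf, map_zero]
      exact zero_mem _
    | (k + 1 : ℕ), hx =>
      obtain ⟨f, hf, rfl⟩ := mem_component.mp hx
      rw [show ((k + 1 : ℕ) : ℤ) - 1 = (k : ℕ) by simp]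
      exact mem_component.mpr ⟨_, loweringPoly_isHomogeneous d hf, rfl⟩
    | Int.negSucc k, hx =>
      rw [(Submodule.mem_bot F).mp hx, map_zero]
      exact zero_mem _
  comm j x hx := by
    match j, hx with
    | (k : ℕ), hx =>
      obtain ⟨f, hf, rfl⟩ := mem_component.mp hx
      have := congrArg (Ideal.Quotient.mkₐ F (monomialCIIdeal F d)) (sum_X_mul_loweringPoly d hf)
      rw [map_mul, map_add, map_smul] at this
      simp only [Ideal.Quotient.mkₐ_eq_mk] at this
      rw [LinearMap.mulLeft_apply, LinearMap.mulLeft_apply, lowering_mk, sum_y_eq_mk, this,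
        ← map_mul, lowering_mk]
      push_cast
      rfl
    | Int.negSucc k, hx =>
      rw [(Submodule.mem_bot F).mp hx]
      simp

theorem intComponent_eq_bot_of_neg (j : ℤ) (hj : j < 0) : intComponent F d j = ⊥ := by
  match j, hj with
  | Int.negSucc k, _ => rfl

theorem intComponent_eq_bot_of_lt (j : ℤ) (hj : ((∑ i, d i : ℕ) : ℤ) < j) :
    intComponent F d j = ⊥ := by
  match j, hj with
  | (k : ℕ), hj =>
    refine (Submodule.eq_bot_iff _).mpr fun x hx => ?_
    obtain ⟨f, hf, rfl⟩ := mem_component.mp hx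
    exact Ideal.Quotient.eq_zero_iff_mem.mpr (mem_of_isHomogeneous hf (by exact_mod_cast hj))

end MonomialCI

theorem mainTheorem1 {F : Type*} [Field F] (p : ℕ) [CharP F p] {r : ℕ} (d : Fin r → ℕ) (n : ℕ)
    (hn : n = ∑ i, d i) (hp : p = 0 ∨ n < p) (k : ℕ) (hk : 2 * k ≤ n) :
    Set.BijOn (fun b : MonomialCI F d => (∑ i, MonomialCI.y F d i) ^ (n - 2 * k) * b)
      (MonomialCI.component F d k : Set (MonomialCI F d))
      (MonomialCI.component F d (n - k) : Set (MonomialCI F d)) := by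
  have h := (MonomialCI.isLefschetzPair F d).bijOn (MonomialCI.intComponent_eq_bot_of_neg F d)
    (MonomialCI.intComponent_eq_bot_of_lt F d) (N := n - 2 * k) (k := k) (by omega) (by
      -- Here `N + k = n - k ≤ n`, so `p` cannot divide `i`.
      intro i hi hik h0
      rw [CharP.cast_eq_zero_iff F p] at h0
      obtain rfl | hp := hp
      · exact hi.ne' (Nat.eq_zero_of_zero_dvd h0)
      · exact absurd (Nat.le_of_dvd hi h0) (by omega))
  rw [show ((∑ i, d i : ℕ) : ℤ) - k = ((n - k : ℕ) : ℤ) by omega] at h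
  rw [LinearMap.pow_mulLeft] at h
  exact h
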